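/- Let $k$ be an algebraically closed field of characteristic $0$, $A=k[X_0,X_1,X_2]$, and let $X\subset\mathbb P_2$ be an irreducible plane curve of degree $d$, i.e. the curve defined by an irreducible homogeneous polynomial $f\in A$ of degree $d$; put $A_X=A/(f)$. A group of points $Y$ on $X$ is a (possibly empty) closed subscheme of pure dimension $0$ of $\mathbb P_2$ contained in $X$, given by its saturated homogeneous ideal $I_Y\supseteq (f)$; put $I_{Y/X}=I_Y/(f)\subset A_X$. Let $L_0,L_1$ be linear forms without common zero on $X$ and $R=k[L_0,L_1]$. The ideal $I_{Y/X}$ is a graded free $R$-module of rank $d$, $I_{Y/X}\simeq\bigoplus_{i=0}^{d-1}R[-n_i]$ with $n_0\le\dots\le n_{d-1}$; the sequence $(n_i)$, which does not depend on $L_0,L_1$, is the relative characteristic sequence of $Y$ on $X$. Theorem. For every sequence of integers $(n_i)_{0\le i\le d-1}$ with $n_i\ge i$ for $0\le i\le d-1$ and $n_i\le n_{i+1}\le n_i+1$ for $0\le i\le d-2$, there is a group of points $Y$ on $X$, whose sheaf of ideals in $\mathcal O_X$ is locally principal, such that $(n_i)$ is the relative characteristic sequence of $Y$ on $X$. -/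

import Mathlib

open MvPolynomial

attribute [local instance] MvPolynomial.gradedAlgebra

/-- An ideal `I` of `k[X₀,…,Xₙ]` is saturated when it contains every polynomial all of whose
products with the homogeneous polynomials of some degree `m` lie in `I`. -/
def IsSaturatedIdeal {k : Type*} [Field k] {n : ℕ}
    (I : Ideal (MvPolynomial (Fin (n + 1)) k)) : Prop :=
  ∀ P : MvPolynomial (Fin (n + 1)) k,
    (∃ m : ℕ, ∀ Q : MvPolynomial (Fin (n + 1)) k, Q.IsHomogeneous m → P * Q ∈ I) → P ∈ I

/-- The saturated homogeneous ideals of `k[X₀,…,Xₙ]`, i.e. the ideals of the closed subschemes of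
projective `n`-space. The empty subscheme corresponds to the unit ideal. -/
structure IsProjectiveSubscheme {k : Type*} [Field k] {n : ℕ}
    (I : Ideal (MvPolynomial (Fin (n + 1)) k)) : Prop where
  homogeneous : I.IsHomogeneous (homogeneousSubmodule (Fin (n + 1)) k)
  saturated : IsSaturatedIdeal I

/-- All components of the projective subscheme with ideal `I` (embedded ones included) have
dimension `m`, i.e. their cones have dimension `m + 1`. The empty subscheme has every dimension. -/
def IsPureDimensional {k : Type*} [Field k] {n : ℕ}
    (I : Ideal (MvPolynomial (Fin (n + 1)) k)) (m : ℕ) : Prop :=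
  ∀ P ∈ associatedPrimes (MvPolynomial (Fin (n + 1)) k) (MvPolynomial (Fin (n + 1)) k ⧸ I),
    ringKrullDim (MvPolynomial (Fin (n + 1)) k ⧸ P) = ((m + 1 : ℕ) : WithBot ℕ∞)

/-- A group of points of projective `n`-space: a projective subscheme of pure dimension `0`,
possibly empty or non-reduced, given by its saturated ideal. -/
structure IsGroupOfPoints {k : Type*} [Field k] {n : ℕ}
    (I : Ideal (MvPolynomial (Fin (n + 1)) k)) : Prop where
  isProjectiveSubscheme : IsProjectiveSubscheme I
  pure : IsPureDimensional I 0

/-- `x` is a zero of all the elements of `I`. -/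
def IsZeroOf {k : Type*} [Field k] {n : ℕ}
    (I : Ideal (MvPolynomial (Fin (n + 1)) k)) (x : Fin (n + 1) → k) : Prop :=
  ∀ g ∈ I, eval x g = 0

/-- For `IX ≤ IY` (that is, `Y ⊆ X`), over an algebraically closed field: the sheaf of ideals of
`Y` in `X` is locally principal. At each point `x` of `X` its stalk, which consists of
the fractions `u / v` with `u ∈ IY` and `v` homogeneous of the same degree and `v x ≠ 0` (taken
modulo `IX`), is generated by a single element; clearing denominators, there are a homogeneous
`g ∈ IY` and a homogeneous `h` with `h x ≠ 0` such that `h * IY ⊆ (g) + IX`. -/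
def IsLocallyPrincipalIn {k : Type*} [Field k] {n : ℕ}
    (IX IY : Ideal (MvPolynomial (Fin (n + 1)) k)) : Prop :=
  ∀ x : Fin (n + 1) → k, x ≠ 0 → IsZeroOf IX x →
    ∃ (g h : MvPolynomial (Fin (n + 1)) k) (a b : ℕ),
      g ∈ IY ∧ g.IsHomogeneous a ∧ h.IsHomogeneous b ∧ eval x h ≠ 0 ∧
        ∀ u ∈ IY, h * u ∈ Ideal.span {g} ⊔ IX

/-- `L₀,…,Lₘ` are linear forms without common zero on the projective subscheme with ideal `IX`
(over an algebraically closed field). When `X` has dimension `m`, they are algebraically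
independent in the coordinate ring of `X`, which is finite over `k[L₀,…,Lₘ]`. -/
structure IsLinearSystemOfParameters {k : Type*} [Field k] {n : ℕ} (m : ℕ)
    (IX : Ideal (MvPolynomial (Fin (n + 1)) k))
    (L : Fin (m + 1) → MvPolynomial (Fin (n + 1)) k) : Prop where
  linear : ∀ i, (L i).IsHomogeneous 1
  no_common_zero : ∀ x : Fin (n + 1) → k, IsZeroOf IX x → (∀ i, eval x (L i) = 0) → x = 0

/-- The subring `k[L₀,…,Lₘ]` of the coordinate ring `k[X₀,…,Xₙ] ⧸ IX`. -/
noncomputable abbrev parameterSubring {k : Type*} [Field k] {n m : ℕ}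
    (IX : Ideal (MvPolynomial (Fin (n + 1)) k))
    (L : Fin (m + 1) → MvPolynomial (Fin (n + 1)) k) :
    Subalgebra k (MvPolynomial (Fin (n + 1)) k ⧸ IX) :=
  Algebra.adjoin k (Set.range fun i => Ideal.Quotient.mk IX (L i))

/-- The ideal `IY / IX` of `Y ⊆ X` in the coordinate ring `k[X₀,…,Xₙ] ⧸ IX` of `X`, regarded as a
module over `k[L₀,…,Lₘ]`. -/
noncomputable abbrev relativeIdeal {k : Type*} [Field k] {n m : ℕ}
    (IX IY : Ideal (MvPolynomial (Fin (n + 1)) k))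
    (L : Fin (m + 1) → MvPolynomial (Fin (n + 1)) k) :
    Submodule (parameterSubring IX L) (MvPolynomial (Fin (n + 1)) k ⧸ IX) :=
  (IY.map (Ideal.Quotient.mk IX)).restrictScalars (parameterSubring IX L)

/-- Let `X`, of dimension `m`, and `Y ⊆ X` be projective subschemes with ideals `IX ≤ IY`. The
nondecreasing sequence `ν` is the relative characteristic sequence of `Y` in `X` when `IY / IX` is
isomorphic to `⨁ R[-ν i]` as a graded module over `R = k[L₀,…,Lₘ]`, i.e. has an `R`-basis made of
homogeneous elements of degrees `ν i`. Here the `Lⱼ` are linear forms without common zero on `X`;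
the sequence is determined by the Hilbert function of `IY / IX` and does not depend on them. -/
def IsRelativeCharacteristicSequence {k : Type*} [Field k] {n : ℕ} (m : ℕ)
    (IX IY : Ideal (MvPolynomial (Fin (n + 1)) k)) {d : ℕ} (ν : Fin d → ℕ) : Prop :=
  Monotone ν ∧
    ∃ L : Fin (m + 1) → MvPolynomial (Fin (n + 1)) k,
      IsLinearSystemOfParameters m IX L ∧
        ∃ e : Module.Basis (Fin d) (parameterSubring IX L) (relativeIdeal IX IY L),
          ∀ i, ∃ g : MvPolynomial (Fin (n + 1)) k,
            g.IsHomogeneous (ν i) ∧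
              ((e i : relativeIdeal IX IY L) : MvPolynomial (Fin (n + 1)) k ⧸ IX) =
                Ideal.Quotient.mk IX g

/-! ### Ideals of lines through the origin -/

/-! Project from a point off the curve, say `(1 : α : β)`. With R = k[`formX α`, `formY β`], the
plane's coordinate ring is R[`X 0`] (`toPoly`), and f becomes, up to a nonzero scalar, monic of
degree d in `X 0`. So A_X is represented by polynomials of degree < d in `X 0`, and the ideal of Y
can be studied through leading coefficients.

Put s_i = n_i - i. The hypotheses say that s is nonnegative, nonincreasing, and drops by at most 1
at each step. Take s_0 lines ℓ_j of the pencil through the vertex, each meeting X in d distinct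
points (`infinite_separable_fiber`), and let Y consist of a_j of these points on ℓ_j, where a_j is
the number of i with s_i > j (`exists_conjugate_sequence`).

An element of I_Y of degree at most i in `X 0` restricts to zero on every line carrying more than i
points of Y, that is, for j < s_i. Its coefficient of `X 0 ^ i` is therefore divisible by ∏_{j <
s_i} ℓ_j (`dvd_coeff_toPoly`). Conversely this product is attained by a form of degree s_i + i =
n_i: the product times a form of degree i, monic in `X 0`, that vanishes at the points on the
remaining lines (`exists_triangular_form`). That form exists because these lines carry at most i
points each, in pairwise distinct numbers (`exists_form_eval_eq`); distinctness is exactly where the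
step bound on s enters. The forms obtained are triangular in `X 0`, hence an R-basis of I_{Y/X}.
Transversality makes Y locally principal: near a point of Y the line ℓ_j cuts out that point on X.
-/

theorem aeval_mul_of_isHomogeneous {σ R S : Type*} [CommSemiring R] [CommSemiring S]
    [Algebra R S] {p : MvPolynomial σ R} {n : ℕ} (hp : p.IsHomogeneous n) (c : S) (w : σ → S) :
    aeval (fun i => c * w i) p = c ^ n * aeval w p := by
  rw [aeval_def, eval₂_eq, aeval_def, eval₂_eq, Finset.mul_sum]
  refine Finset.sum_congr rfl fun m hm => ?_
  rw [hp.degree_eq_sum_deg_support hm, ← Finset.prod_pow_eq_pow_sum]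
  simp_rw [mul_pow]
  rw [Finset.prod_mul_distrib]
  ring

theorem eval_mul_of_isHomogeneous {σ R : Type*} [CommSemiring R]
    {p : MvPolynomial σ R} {n : ℕ} (hp : p.IsHomogeneous n) (c : R) (w : σ → R) :
    eval (fun i => c * w i) p = c ^ n * eval w p := by
  simpa [coe_aeval_eq_eval] using aeval_mul_of_isHomogeneous hp c w

section Line

variable {σ k : Type*} [Field k]

/-- Restriction of polynomials to the line through the origin spanned by `v`. -/
noncomputable def lineHom (v : σ → k) : MvPolynomial σ k →ₐ[k] Polynomial k :=
  aeval fun i => Polynomial.X * Polynomial.C (v i)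

/-- The ideal of the line through the origin spanned by `v`. -/
noncomputable def lineIdeal (v : σ → k) : Ideal (MvPolynomial σ k) :=
  RingHom.ker (lineHom v)

theorem lineHom_of_isHomogeneous (v : σ → k) {p : MvPolynomial σ k} {n : ℕ}
    (hp : p.IsHomogeneous n) : lineHom v p = Polynomial.C (eval v p) * Polynomial.X ^ n := by
  rw [lineHom, aeval_mul_of_isHomogeneous hp, mul_comm]
  congr 1
  have : (aeval fun i => Polynomial.C (v i) : MvPolynomial σ k →ₐ[k] Polynomial k) =
      (Algebra.ofId k (Polynomial k)).comp (aeval v) := by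
    ext i; simp [Algebra.ofId_apply]
  rw [this]
  simp [Algebra.ofId_apply]

theorem mem_lineIdeal {v : σ → k} {p : MvPolynomial σ k} : p ∈ lineIdeal v ↔ lineHom v p = 0 :=
  Iff.rfl

theorem mem_lineIdeal_of_isHomogeneous {v : σ → k} {p : MvPolynomial σ k} {n : ℕ}
    (hp : p.IsHomogeneous n) : p ∈ lineIdeal v ↔ eval v p = 0 := by
  rw [mem_lineIdeal, lineHom_of_isHomogeneous v hp]
  simp

instance lineIdeal_isPrime (v : σ → k) : (lineIdeal v).IsPrime :=
  RingHom.ker_isPrime _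

/-- The degree n component restricts to a multiple of `X ^ n` on the line, so a vanishing
restriction forces each component to vanish there. -/
theorem lineIdeal_isHomogeneous (v : σ → k) :
    (lineIdeal v).IsHomogeneous (homogeneousSubmodule σ k) := by
  intro n p hp
  rw [show ((DirectSum.decompose (homogeneousSubmodule σ k) p) n : MvPolynomial σ k) =
    homogeneousComponent n p from decomposition.decompose'_apply p n]
  rw [mem_lineIdeal_of_isHomogeneous (homogeneousComponent_isHomogeneous n p)]
  have h : lineHom v p = ∑ i ∈ Finset.range (p.totalDegree + 1),
      Polynomial.C (eval v (homogeneousComponent i p)) * Polynomial.X ^ i := by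
    conv_lhs => rw [← sum_homogeneousComponent p]
    rw [map_sum]
    exact Finset.sum_congr rfl fun i _ =>
      lineHom_of_isHomogeneous v (homogeneousComponent_isHomogeneous i p)
  rw [mem_lineIdeal.1 hp] at h
  by_cases hn : n ≤ p.totalDegree
  · have := congrArg (Polynomial.coeff · n) h
    simp only [Polynomial.finsetSum_coeff, Polynomial.coeff_C_mul_X_pow] at this
    rw [Finset.sum_ite_eq, if_pos (by simpa [Nat.lt_succ_iff] using hn)] at this
    simpa using this.symm
  · rw [homogeneousComponent_eq_zero _ _ (not_le.1 hn), map_zero]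

theorem lineHom_surjective {v : σ → k} (hv : v ≠ 0) : Function.Surjective (lineHom v) := by
  obtain ⟨i, hi⟩ := Function.ne_iff.1 hv
  rw [← AlgHom.range_eq_top, ← top_le_iff, ← Polynomial.adjoin_X, Algebra.adjoin_le_iff]
  rintro _ rfl
  refine ⟨C (v i)⁻¹ * X i, ?_⟩
  have hi' : v i ≠ 0 := hi
  change lineHom v _ = _
  rw [map_mul, lineHom, aeval_C, aeval_X, Polynomial.algebraMap_eq, mul_left_comm, ← map_mul,
    inv_mul_cancel₀ hi', map_one, mul_one]

theorem ringKrullDim_quotient_lineIdeal {v : σ → k} (hv : v ≠ 0) :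
    ringKrullDim (MvPolynomial σ k ⧸ lineIdeal v) = 1 := by
  have e := ringKrullDim_eq_of_ringEquiv
    (RingHom.quotientKerEquivOfSurjective (f := (lineHom v : MvPolynomial σ k →+* Polynomial k))
      (lineHom_surjective hv))
  refine e.trans ?_
  rw [Polynomial.ringKrullDim_of_isNoetherianRing, ringKrullDim_eq_zero_of_field, zero_add]

end Line

/-! ### Saturated ideals of finite sets of points -/

section Points

variable {k : Type*} [Field k] {n : ℕ}

theorem isSaturatedIdeal_lineIdeal {v : Fin (n + 1) → k} (hv : v ≠ 0) :
    IsSaturatedIdeal (lineIdeal v) := by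
  rintro P ⟨m, hm⟩
  obtain ⟨i, hi⟩ := Function.ne_iff.1 hv
  refine ((lineIdeal_isPrime v).mem_or_mem (hm (X i ^ m) (isHomogeneous_X_pow i m))).resolve_right
    fun h => hi ?_
  have := (mem_lineIdeal_of_isHomogeneous (isHomogeneous_X_pow i m)).1 h
  simp only [map_pow, eval_X] at this
  exact eq_zero_of_pow_eq_zero this

/-- The ideal of a finite set of points of the projective space. -/
noncomputable def pointsIdeal (S : Finset (Fin (n + 1) → k)) :
    Ideal (MvPolynomial (Fin (n + 1)) k) :=
  ⨅ v ∈ S, lineIdeal v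

theorem mem_pointsIdeal {S : Finset (Fin (n + 1) → k)} {p : MvPolynomial (Fin (n + 1)) k} :
    p ∈ pointsIdeal S ↔ ∀ v ∈ S, p ∈ lineIdeal v := by
  simp [pointsIdeal, Submodule.mem_iInf]

theorem isGroupOfPoints_pointsIdeal {S : Finset (Fin (n + 1) → k)} (hS : ∀ v ∈ S, v ≠ 0) :
    IsGroupOfPoints (pointsIdeal S) := by
  refine ⟨⟨?_, ?_⟩, ?_⟩
  · exact Ideal.IsHomogeneous.iInf₂ fun v _ => lineIdeal_isHomogeneous v
  · rintro P ⟨m, hm⟩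
    exact mem_pointsIdeal.2 fun v hv => isSaturatedIdeal_lineIdeal (hS v hv) P
      ⟨m, fun Q hQ => mem_pointsIdeal.1 (hm Q hQ) v hv⟩
  · intro P hP
    rw [AssociatedPrimes.mem_iff, isAssociatedPrime_iff] at hP
    obtain ⟨hprime, a, ha⟩ := hP
    obtain ⟨a, rfl⟩ := Ideal.Quotient.mk_surjective a
    -- `P` is the annihilator of the class of `a`, i.e. the intersection of the line ideals that do
    -- not contain `a`; being prime, it is one of them.
    have hmem : ∀ u, u ∈ P ↔ ∀ v ∈ S, u ∈ lineIdeal v ∨ a ∈ lineIdeal v := by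
      intro u
      rw [ha, Submodule.mem_colon_singleton, Submodule.mem_bot]
      change Ideal.Quotient.mk _ (u * a) = 0 ↔ _
      rw [Ideal.Quotient.eq_zero_iff_mem, mem_pointsIdeal]
      exact forall₂_congr fun v _ => (lineIdeal_isPrime v).mul_mem_iff_mem_or_mem
    classical
    have hle : (S.filter fun v => a ∉ lineIdeal v).inf lineIdeal ≤ P := by
      intro u hu
      rw [Submodule.mem_finsetInf] at hu
      refine (hmem u).2 fun v hv => ?_
      by_cases h : a ∈ lineIdeal v
      · exact Or.inr h
      · exact Or.inl (hu v (Finset.mem_filter.2 ⟨hv, h⟩))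
    obtain ⟨v, hv, hvP⟩ := hprime.inf_le'.1 hle
    rw [Finset.mem_filter] at hv
    have : P = lineIdeal v :=
      le_antisymm (fun u hu => ((hmem u).1 hu v hv.1).resolve_right hv.2) hvP
    rw [this, ringKrullDim_quotient_lineIdeal (hS v hv.1)]
    simp

end Points

/-! ### Coordinates adapted to the point `(1 : α : β)` of the plane -/

section Coordinates

variable {k : Type*} [Field k] (α β : k)

/-- The first of the two linear forms that cut out the point `(1 : α : β)`. -/
noncomputable def formX : MvPolynomial (Fin (2 + 1)) k := X 1 - C α * X 0

/-- The second of the two linear forms that cut out the point `(1 : α : β)`. -/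
noncomputable def formY : MvPolynomial (Fin (2 + 1)) k := X 2 - C β * X 0

/-- The linear form of slope `t` in the pencil of lines through `(1 : α : β)`. -/
noncomputable def pencilForm (t : k) : MvPolynomial (Fin (2 + 1)) k :=
  formY β - C t * formX α

/-- The point at which `formX`, `formY` and `X 0` take the values `1`, `t` and `b`. -/
def chart (t b : k) : Fin (2 + 1) → k := ![b, 1 + α * b, t + β * b]

theorem formX_isHomogeneous : (formX α).IsHomogeneous 1 :=
  (isHomogeneous_X k 1).sub ((isHomogeneous_X k 0).C_mul α)

theorem formY_isHomogeneous : (formY β).IsHomogeneous 1 :=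
  (isHomogeneous_X k 2).sub ((isHomogeneous_X k 0).C_mul β)

theorem pencilForm_isHomogeneous (t : k) : (pencilForm α β t).IsHomogeneous 1 :=
  (formY_isHomogeneous β).sub ((formX_isHomogeneous α).C_mul t)

@[simp] theorem eval_chart_formX (t b : k) : eval (chart α β t b) (formX α) = 1 := by
  simp [chart, formX]

@[simp] theorem eval_chart_formY (t b : k) : eval (chart α β t b) (formY β) = t := by
  simp [chart, formY]

@[simp] theorem eval_chart_X_zero (t b : k) : eval (chart α β t b) (X 0) = b := by
  simp [chart]

@[simp] theorem eval_chart_pencilForm (t t' b : k) :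
    eval (chart α β t b) (pencilForm α β t') = t - t' := by
  simp [pencilForm]

theorem eval_vertex_formX : eval ![1, α, β] (formX α) = 0 := by simp [formX]

theorem eval_vertex_formY : eval ![1, α, β] (formY β) = 0 := by simp [formY]

theorem eval_vertex_pencilForm (t : k) : eval ![1, α, β] (pencilForm α β t) = 0 := by
  simp [pencilForm, eval_vertex_formX, eval_vertex_formY]

theorem chart_ne_zero (t b : k) : chart α β t b ≠ 0 := fun h => by
  have := eval_chart_formX α β t b
  rw [h] at this
  simp [formX] at this

theorem eq_mul_chart {w : Fin (2 + 1) → k} {t b : k}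
    (hY : eval w (pencilForm α β t) = 0) (hZ : eval w (X 0 - C b * formX α) = 0) :
    w = fun i => eval w (formX α) * chart α β t b i := by
  simp only [pencilForm, formX, formY, map_sub, map_mul, eval_C, eval_X] at hY hZ ⊢
  funext i
  fin_cases i
  · simp [chart]; linear_combination hZ
  · simp [chart]; linear_combination α * hZ
  · simp [chart]; linear_combination hY + β * hZ

/-- The linear change of coordinates with inverse `X 1 ↦ formX`, `X 2 ↦ formY`. -/
noncomputable def shear : MvPolynomial (Fin (2 + 1)) k ≃ₐ[k] MvPolynomial (Fin (2 + 1)) k :=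
  AlgEquiv.ofAlgHom (aeval ![X 0, X 1 + C α * X 0, X 2 + C β * X 0])
    (aeval ![X 0, formX α, formY β])
    (by ext i; fin_cases i <;> simp [formX, formY, algebraMap_eq])
    (by ext i; fin_cases i <;> simp [formX, formY, algebraMap_eq])

theorem shear_apply (p : MvPolynomial (Fin (2 + 1)) k) :
    shear α β p = aeval ![X 0, X 1 + C α * X 0, X 2 + C β * X 0] p := rfl

theorem shear_isHomogeneous {p : MvPolynomial (Fin (2 + 1)) k} {n : ℕ} (hp : p.IsHomogeneous n) :
    (shear α β p).IsHomogeneous n := by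
  rw [shear_apply, ← one_mul n]
  refine hp.aeval _ fun i => ?_
  fin_cases i
  · exact isHomogeneous_X k 0
  · exact (isHomogeneous_X k 1).add ((isHomogeneous_X k 0).C_mul α)
  · exact (isHomogeneous_X k 2).add ((isHomogeneous_X k 0).C_mul β)

theorem eval_shear (p : MvPolynomial (Fin (2 + 1)) k) (a b c : k) :
    eval ![a, b, c] (shear α β p) = eval ![a, b + α * a, c + β * a] p := by
  rw [shear_apply]
  simp only [← coe_aeval_eq_eval, RingHom.coe_coe]
  rw [← AlgHom.comp_apply]
  congr 1
  ext i
  fin_cases i <;> simp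

/-- Polynomials in three variables as polynomials in `X 0` over `k[formX, formY]`. -/
noncomputable def toPoly :
    MvPolynomial (Fin (2 + 1)) k ≃ₐ[k] Polynomial (MvPolynomial (Fin 2) k) :=
  (shear α β).trans (finSuccEquiv k 2)

theorem toPoly_apply (p : MvPolynomial (Fin (2 + 1)) k) :
    toPoly α β p = finSuccEquiv k 2 (shear α β p) := rfl

@[simp] theorem toPoly_X_zero : toPoly α β (X 0) = Polynomial.X := by
  rw [toPoly_apply, shear_apply, aeval_X]
  exact finSuccEquiv_X_zero

@[simp] theorem toPoly_C (c : k) : toPoly α β (C c) = Polynomial.C (C c) := by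
  rw [toPoly_apply, shear_apply, aeval_C, finSuccEquiv_apply]
  simp [algebraMap_eq]

@[simp] theorem toPoly_formX : toPoly α β (formX α) = Polynomial.C (X 0) := by
  rw [toPoly_apply, shear_apply]
  simp only [formX, map_sub, map_mul, aeval_X, aeval_C]
  simp only [algebraMap_eq, Matrix.cons_val_one, Matrix.cons_val_zero, map_add, map_mul,
    add_sub_cancel_right]
  exact finSuccEquiv_X_succ (j := 0)

@[simp] theorem toPoly_formY : toPoly α β (formY β) = Polynomial.C (X 1) := by
  rw [toPoly_apply, shear_apply]
  simp only [formY, map_sub, map_mul, aeval_X, aeval_C]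
  simp only [algebraMap_eq, Matrix.cons_val, Matrix.cons_val_zero, map_add, map_mul,
    add_sub_cancel_right]
  exact finSuccEquiv_X_succ (j := 1)

theorem toPoly_aeval (q : MvPolynomial (Fin 2) k) :
    toPoly α β (aeval ![formX α, formY β] q) = Polynomial.C q := by
  have : ((toPoly α β).toAlgHom.comp (aeval ![formX α, formY β])) =
      (Algebra.ofId (MvPolynomial (Fin 2) k) _).restrictScalars k := by
    ext i : 1
    fin_cases i <;> simp [Algebra.ofId_apply]
  exact DFunLike.congr_fun this q

theorem natDegree_toPoly_le {p : MvPolynomial (Fin (2 + 1)) k} {n : ℕ}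
    (hp : p.IsHomogeneous n) : (toPoly α β p).natDegree ≤ n := by
  rw [toPoly_apply, natDegree_finSuccEquiv]
  exact (degreeOf_le_totalDegree _ _).trans (shear_isHomogeneous α β hp).totalDegree_le

/-- This coefficient is a form of degree 0, and the coefficients of lower powers of `X 0`, being
forms of positive degree in `formX` and `formY`, vanish at the vertex. Hence a form not vanishing at
the vertex has a nonzero constant as leading coefficient. -/
theorem coeff_toPoly {p : MvPolynomial (Fin (2 + 1)) k} {n : ℕ}
    (hp : p.IsHomogeneous n) : (toPoly α β p).coeff n = C (eval ![1, α, β] p) := by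
  have hs := shear_isHomogeneous α β hp
  have hc : ∀ i j, i + j = n → ((toPoly α β p).coeff i).IsHomogeneous j := fun i j h =>
    hs.finSuccEquiv_coeff_isHomogeneous i j h
  have h0 : eval ![1, α, β] p = eval ![0, 0] ((toPoly α β p).coeff n) := by
    have h1 := eval_shear α β p 1 0 0
    simp only [zero_add, mul_one] at h1
    rw [← h1, show (![1, 0, 0] : Fin 3 → k) = Fin.cons 1 ![0, 0] from rfl,
      eval_eq_eval_mv_eval', ← toPoly_apply, Polynomial.eval_map, Polynomial.eval₂_eq_sum_range'
      (n := n + 1) _ (Nat.lt_succ_of_le (natDegree_toPoly_le α β hp)), Finset.sum_range_succ,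
      Finset.sum_eq_zero]
    · simp
    · intro i hi
      rw [Finset.mem_range] at hi
      have := eval_mul_of_isHomogeneous (hc i (n - i) (by omega)) 0 ![0, 0]
      rw [zero_pow (by omega), zero_mul] at this
      have h00 : (fun i => 0 * ![(0 : k), 0] i) = ![0, 0] := by funext i; fin_cases i <;> simp
      rw [h00] at this
      simp [this]
  rw [h0]
  rw [totalDegree_eq_zero_iff_eq_C.1 ((totalDegree_zero_iff_isHomogeneous _).2 (hc n 0 rfl))]
  simp

/-- Restriction to the plane of slope `t` in the pencil, as a polynomial in `X 0` over the
coordinate ring of its trace on the `formX`, `formY` plane. -/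
noncomputable def restrictSlope (t : k) : MvPolynomial (Fin 2) k →ₐ[k] Polynomial k :=
  aeval ![Polynomial.X, Polynomial.C t * Polynomial.X]

/-- Vanishing at the point of ordinate `b` thus means that the restriction to slope `t` has the root
`b X`, so points on a line of the pencil can be counted as roots. -/
theorem lineHom_chart (t b : k) (p : MvPolynomial (Fin (2 + 1)) k) :
    lineHom (chart α β t b) p =
      ((toPoly α β p).map (restrictSlope t : MvPolynomial (Fin 2) k →+* Polynomial k)).eval
        (Polynomial.C b * Polynomial.X) := by
  have : lineHom (chart α β t b) = (((Polynomial.aeval (Polynomial.C b * Polynomial.X) :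
      Polynomial (Polynomial k) →ₐ[Polynomial k] Polynomial k).restrictScalars k).comp
        (Polynomial.mapAlgHom (restrictSlope t))).comp (toPoly α β).toAlgHom := by
    have hx : ∀ i, (X i : MvPolynomial (Fin (2 + 1)) k) =
      (![X 0, formX α + C α * X 0, formY β + C β * X 0] : Fin 3 → _) i := by
      intro i; fin_cases i <;> simp [formX, formY]
    ext i : 1
    rw [AlgHom.comp_apply]
    conv_rhs => rw [hx i]
    fin_cases i <;> simp [lineHom, chart, restrictSlope] <;> ring
  rw [this]
  simp

/-- Modulo `X 1 - C t * X 0`, the quotient map factors through `restrictSlope t`. -/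
theorem dvd_of_restrictSlope_eq_zero {t : k} {q : MvPolynomial (Fin 2) k}
    (hq : restrictSlope t q = 0) : X 1 - C t * X 0 ∣ q := by
  rw [← Ideal.mem_span_singleton, ← Ideal.Quotient.eq_zero_iff_mem]
  set I := Ideal.span {(X 1 - C t * X 0 : MvPolynomial (Fin 2) k)}
  have : (Ideal.Quotient.mkₐ k I) =
      (Polynomial.aeval (Ideal.Quotient.mk I (X 0))).comp (restrictSlope t) := by
    ext i : 1
    fin_cases i
    · simp [restrictSlope]
    · simp only [restrictSlope, AlgHom.comp_apply, aeval_X, Ideal.Quotient.mkₐ_eq_mk]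
      simp
      rw [IsScalarTower.algebraMap_apply k (MvPolynomial (Fin 2) k) (MvPolynomial (Fin 2) k ⧸ I)]
      rw [Ideal.Quotient.algebraMap_eq, ← map_mul, Ideal.Quotient.eq]
      exact Ideal.mem_span_singleton_self _
  rw [← Ideal.Quotient.mkₐ_eq_mk k, this, AlgHom.comp_apply, hq, map_zero]

theorem restrictSlope_self (t : k) : restrictSlope t (X 1 - C t * X 0) = 0 := by
  simp [restrictSlope]

theorem prime_slope (t : k) : Prime (X 1 - C t * X 0 : MvPolynomial (Fin 2) k) := by
  have h0 : (X 1 - C t * X 0 : MvPolynomial (Fin 2) k) ≠ 0 := fun h => by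
    have := congrArg (eval ![0, 1]) h
    simp at this
  rw [← Ideal.span_singleton_prime h0]
  have : Ideal.span {(X 1 - C t * X 0 : MvPolynomial (Fin 2) k)} =
      RingHom.ker (restrictSlope t) := by
    apply le_antisymm
    · rw [Ideal.span_singleton_le_iff_mem]
      exact restrictSlope_self t
    · intro q hq
      exact Ideal.mem_span_singleton.2 (dvd_of_restrictSlope_eq_zero hq)
  rw [this]
  exact RingHom.ker_isPrime _

theorem isRelPrime_slope {t t' : k} (h : t ≠ t') :
    IsRelPrime (X 1 - C t * X 0 : MvPolynomial (Fin 2) k) (X 1 - C t' * X 0) := by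
  refine ((prime_slope t).irreducible.isRelPrime_iff_not_dvd).2 ?_
  rintro ⟨c, hc⟩
  have := congrArg (restrictSlope t) hc
  rw [map_mul, restrictSlope_self, zero_mul] at this
  rw [show (X 1 - C t' * X 0 : MvPolynomial (Fin 2) k) =
    X 1 - C t * X 0 + C (t - t') * X 0 by rw [C_sub]; ring, map_add, restrictSlope_self] at this
  simp [restrictSlope, sub_eq_zero, h] at this

/-- The decomposition of an element of the ideal of a point. -/
theorem exists_eq_add_of_mem_lineIdeal {t b : k} {p : MvPolynomial (Fin (2 + 1)) k}
    (hp : p ∈ lineIdeal (chart α β t b)) :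
    ∃ r q, p = pencilForm α β t * r + (X 0 - C b * formX α) * q := by
  have key : p ∈ Ideal.span {pencilForm α β t, X 0 - C b * formX α} := by
    rw [← Ideal.Quotient.eq_zero_iff_mem]
    set I := Ideal.span {pencilForm α β t, X 0 - C b * formX α}
    have h1 : Ideal.Quotient.mk I (formY β) = Ideal.Quotient.mk I (C t * formX α) :=
      Ideal.Quotient.eq.2 (Ideal.subset_span (by simp [pencilForm]))
    have h2 : Ideal.Quotient.mk I (X 0) = Ideal.Quotient.mk I (C b * formX α) :=
      Ideal.Quotient.eq.2 (Ideal.subset_span (by simp))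
    -- Modulo the two linear forms every variable is a multiple of `formX α`, so the quotient map
    -- factors through restriction to the line.
    have : (Ideal.Quotient.mkₐ k I) =
        (Polynomial.aeval (Ideal.Quotient.mk I (formX α))).comp (lineHom (chart α β t b)) := by
      have e1 : (X 1 : MvPolynomial (Fin (2 + 1)) k) = formX α + C α * X 0 := by simp [formX]
      have e2 : (X 2 : MvPolynomial (Fin (2 + 1)) k) = formY β + C β * X 0 := by simp [formY]
      have hC : ∀ c : k, algebraMap k (MvPolynomial (Fin (2 + 1)) k ⧸ I) c =
        Ideal.Quotient.mk I (C c) := fun c => rfl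
      ext i : 1
      fin_cases i
      · simp [lineHom, chart, h2, hC]
      · simp [lineHom, chart, hC]; rw [e1, map_add, map_mul, h2, map_mul]; ring
      · simp [lineHom, chart, hC]; rw [e2, map_add, map_mul, h1, h2, map_mul, map_mul]; ring
    rw [← Ideal.Quotient.mkₐ_eq_mk k, this, AlgHom.comp_apply, mem_lineIdeal.1 hp, map_zero]
  obtain ⟨r, q, h⟩ := Ideal.mem_span_pair.1 key
  exact ⟨r, q, by rw [← h]; ring⟩

end Coordinates

/-! ### Interpolation by forms at points on the lines of a pencil -/

section Interpolation

variable {k : Type*} [Field k] (α β : k)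

/-- The form of degree `n` in `X 0` and `formX` that dehomogenizes to `q`. -/
noncomputable def homogenization (n : ℕ) (q : Polynomial k) : MvPolynomial (Fin (2 + 1)) k :=
  ∑ m ∈ Finset.range (n + 1), C (q.coeff m) * (X 0 ^ m * formX α ^ (n - m))

theorem homogenization_isHomogeneous (n : ℕ) (q : Polynomial k) :
    (homogenization α n q).IsHomogeneous n := by
  refine IsHomogeneous.sum _ _ _ fun m hm => IsHomogeneous.C_mul ?_ _
  have hm' : m ≤ n := Nat.lt_succ_iff.1 (Finset.mem_range.1 hm)
  have := (isHomogeneous_X_pow (R := k) (0 : Fin (2 + 1)) m).mul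
    ((formX_isHomogeneous α).pow (n - m))
  rwa [one_mul, Nat.add_sub_cancel' hm'] at this

theorem eval_chart_homogenization {n : ℕ} {q : Polynomial k} (hq : q.natDegree ≤ n) (t b : k) :
    eval (chart α β t b) (homogenization α n q) = q.eval b := by
  rw [Polynomial.eval_eq_sum_range' (Nat.lt_succ_of_le hq), homogenization, map_sum]
  exact Finset.sum_congr rfl fun m _ => by simp [show chart α β t b 0 = b from rfl]

theorem eval_vertex_homogenization (n : ℕ) (q : Polynomial k) :
    eval ![1, α, β] (homogenization α n q) = q.coeff n := by
  rw [homogenization, map_sum, Finset.sum_range_succ, Finset.sum_eq_zero]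
  · simp
  · intro m hm
    rw [Finset.mem_range] at hm
    simp [eval_vertex_formX, show n - m ≠ 0 by omega]

/-- Points on distinct lines of a pencil, in distinct numbers at most `n` on the lines, and the
vertex of the pencil impose independent conditions on the forms of degree `n`. -/
theorem exists_form_eval_eq {t : ℕ → k} {B : ℕ → Finset k} (n : ℕ) (T : Finset ℕ)
    (ht : Set.InjOn t T) (hB : ∀ j ∈ T, (B j).card ≤ n)
    (hinj : Set.InjOn (fun j => (B j).card) T) (c : k) (h : ℕ → k → k) :
    ∃ r : MvPolynomial (Fin (2 + 1)) k, r.IsHomogeneous n ∧ eval ![1, α, β] r = c ∧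
      ∀ j ∈ T, ∀ b ∈ B j, eval (chart α β (t j) b) r = h j b := by
  classical
  induction n generalizing T c h with
  | zero =>
    refine ⟨C c, isHomogeneous_C _ _, by simp, fun j hj b hb => ?_⟩
    rw [Finset.card_eq_zero.1 (Nat.le_zero.1 (hB j hj))] at hb
    exact absurd hb (Finset.notMem_empty b)
  | succ n ih =>
    rcases T.eq_empty_or_nonempty with rfl | hT
    · exact ⟨C c * X 0 ^ (n + 1), (isHomogeneous_X_pow 0 (n + 1)).C_mul c, by simp, by simp⟩
    -- Treat a fullest line first: the other lines carry strictly fewer points, hence at most `n`,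
    -- as the induction requires.
    obtain ⟨j₀, hj₀, hmax⟩ := T.exists_max_image (fun j => (B j).card) hT
    have hlt : ∀ j ∈ T.erase j₀, (B j).card < (B j₀).card := fun j hj =>
      lt_of_le_of_ne (hmax j (Finset.mem_of_mem_erase hj)) fun e =>
        Finset.ne_of_mem_erase hj (hinj (Finset.mem_of_mem_erase hj) hj₀ e)
    -- `w` has degree at most `n`, so it corrects the values on line `j₀` without changing the
    -- leading coefficient `c` of `q`.
    set w : Polynomial k :=
      Lagrange.interpolate (B j₀) id (fun b => h j₀ b - c * b ^ (n + 1)) with hw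
    have hwdeg : w.degree < (n + 1 : ℕ) :=
      (Lagrange.degree_interpolate_lt _ Function.injective_id.injOn).trans_le
        (by exact_mod_cast hB j₀ hj₀)
    set q : Polynomial k := Polynomial.C c * Polynomial.X ^ (n + 1) + w with hq
    have hqdeg : q.natDegree ≤ n + 1 :=
      (Polynomial.natDegree_add_le _ _).trans (max_le (Polynomial.natDegree_C_mul_X_pow_le _ _)
        (Polynomial.natDegree_le_of_degree_le hwdeg.le))
    have hqc : q.coeff (n + 1) = c := by
      rw [hq, Polynomial.coeff_add, Polynomial.coeff_C_mul_X_pow, if_pos rfl,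
        Polynomial.coeff_eq_zero_of_degree_lt hwdeg, add_zero]
    have hqe : ∀ b ∈ B j₀, q.eval b = h j₀ b := fun b hb => by
      have : w.eval (id b) = _ :=
        Lagrange.eval_interpolate_at_node _ Function.injective_id.injOn hb
      rw [hq, Polynomial.eval_add, show w.eval b = _ from this]
      simp
    -- The correction is multiplied by `pencilForm α β (t j₀)`, which is zero on line `j₀` and at
    -- the vertex and equals `t j - t j₀` at the chart points of line `j`; the vertex value 0 is
    -- arbitrary.
    obtain ⟨r, hr, -, hre⟩ := ih (T.erase j₀) (ht.mono (Finset.coe_subset.2 (T.erase_subset j₀)))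
      (fun j hj => Nat.lt_succ_iff.1 ((hlt j hj).trans_le (hB j₀ hj₀)))
      (hinj.mono (Finset.coe_subset.2 (T.erase_subset j₀))) 0
      (fun j b => (h j b - q.eval b) / (t j - t j₀))
    refine ⟨homogenization α (n + 1) q + pencilForm α β (t j₀) * r,
      (homogenization_isHomogeneous α _ _).add ?_, ?_, fun j hj b hb => ?_⟩
    · exact add_comm 1 n ▸ (pencilForm_isHomogeneous α β (t j₀)).mul hr
    · rw [map_add, map_mul, eval_vertex_pencilForm, eval_vertex_homogenization, hqc]; ring
    · rw [map_add, map_mul, eval_chart_homogenization α β hqdeg, eval_chart_pencilForm]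
      by_cases hjj : j = j₀
      · subst hjj; rw [sub_self, zero_mul, add_zero, hqe b hb]
      · rw [hre j (Finset.mem_erase.2 ⟨hjj, hj⟩) b hb, mul_div_cancel₀, add_sub_cancel]
        exact sub_ne_zero.2 fun e => hjj (ht hj hj₀ e)

end Interpolation

/-! ### Transversal lines of the pencil -/

section Fiber

variable {k : Type*} [Field k] (α β : k)

/-- Restriction to the affine line on which `formX` and `formY` take the values `s` and `t`. -/
noncomputable def fiber (s t : k) : MvPolynomial (Fin (2 + 1)) k →ₐ[k] Polynomial k :=
  aeval ![Polynomial.X, Polynomial.C s + Polynomial.C α * Polynomial.X,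
    Polynomial.C t + Polynomial.C β * Polynomial.X]

theorem fiber_eq_map (s t : k) (p : MvPolynomial (Fin (2 + 1)) k) :
    fiber α β s t p = (toPoly α β p).map (eval ![s, t]) := by
  have : fiber α β s t = (Polynomial.mapAlgHom (aeval ![s, t])).comp (toPoly α β).toAlgHom := by
    have hx : ∀ i, (X i : MvPolynomial (Fin (2 + 1)) k) =
      (![X 0, formX α + C α * X 0, formY β + C β * X 0] : Fin 3 → _) i := by
      intro i; fin_cases i <;> simp [formX, formY]
    ext i : 1
    rw [AlgHom.comp_apply]
    conv_rhs => rw [hx i]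
    fin_cases i <;> simp [fiber]
  rw [this]
  rfl

theorem eval_fiber (t b : k) (p : MvPolynomial (Fin (2 + 1)) k) :
    (fiber α β 1 t p).eval b = eval (chart α β t b) p := by
  have : (Polynomial.aeval b).comp (fiber α β 1 t) = aeval (chart α β t b) := by
    ext i
    fin_cases i <;> simp [fiber, chart]
  simpa [Polynomial.coe_aeval_eq_eval, coe_aeval_eq_eval] using DFunLike.congr_fun this p

/-- By homogeneity, scaling by `s` carries the fibre over `(1, t / s)` to the one over `(s, t)`;
this normalizes a base point found outside the discriminant. -/
theorem fiber_comp {p : MvPolynomial (Fin (2 + 1)) k} {d : ℕ} (hp : p.IsHomogeneous d)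
    {s : k} (hs : s ≠ 0) (t : k) :
    (fiber α β s t p).comp (Polynomial.C s * Polynomial.X) =
      Polynomial.C s ^ d * fiber α β 1 (t / s) p := by
  rw [fiber, fiber, ← aeval_mul_of_isHomogeneous hp]
  have : (Polynomial.aeval (Polynomial.C s * Polynomial.X : Polynomial k)).comp (fiber α β s t) =
      aeval fun i => Polynomial.C s * (![Polynomial.X, Polynomial.C 1 + Polynomial.C α *
        Polynomial.X, Polynomial.C (t / s) + Polynomial.C β * Polynomial.X] : Fin (2 + 1) → _) i := by
    ext i : 1
    fin_cases i
    · simp [fiber]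
    · simp [fiber]; ring
    · have : (Polynomial.C s * Polynomial.C (t / s) : Polynomial k) = Polynomial.C t := by
        rw [← Polynomial.C_mul, mul_div_cancel₀ _ hs]
      simp only [fiber, AlgHom.comp_apply, aeval_X]
      simp [mul_add, this]; ring
  exact DFunLike.congr_fun this p

theorem separable_comp_C_mul_X {p : Polynomial k} (hp : p.Separable) {s : k}
    (hs : s ≠ 0) : (p.comp (Polynomial.C s * Polynomial.X)).Separable := by
  obtain ⟨a, b, h⟩ := hp
  refine ⟨a.comp (Polynomial.C s * Polynomial.X),
    Polynomial.C s⁻¹ * b.comp (Polynomial.C s * Polynomial.X), ?_⟩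
  have := congrArg (fun q => q.comp (Polynomial.C s * Polynomial.X)) h
  simp only [Polynomial.add_comp, Polynomial.mul_comp, Polynomial.one_comp] at this
  rw [Polynomial.derivative_comp, Polynomial.derivative_C_mul, Polynomial.derivative_X, mul_one]
  have h1 : (Polynomial.C s⁻¹ * Polynomial.C s : Polynomial k) = 1 := by
    rw [← Polynomial.C_mul, inv_mul_cancel₀ hs, Polynomial.C_1]
  linear_combination this + (b.comp (Polynomial.C s * Polynomial.X) *
    (Polynomial.derivative p).comp (Polynomial.C s * Polynomial.X)) * h1

/-- An irreducible polynomial of positive degree over a unique factorization domain of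
characteristic zero has a nonzero multiple of its discriminant. -/
theorem exists_eq_mul_add_mul_derivative {R : Type*} [CommRing R] [IsDomain R]
    [NormalizedGCDMonoid R] [CharZero R] {F : Polynomial R} (hF : Irreducible F)
    (hd : F.natDegree ≠ 0) :
    ∃ D : R, D ≠ 0 ∧ ∃ a b : Polynomial R,
      a * F + b * Polynomial.derivative F = Polynomial.C D := by
  let K := FractionRing R
  have hprim := hF.isPrimitive hd
  have : CharZero K := charZero_of_injective_algebraMap (IsFractionRing.injective R K)
  -- By Gauss's lemma `F` stays irreducible over the fraction field, hence is separable in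
  -- characteristic zero; the Bézout identity is then cleared of denominators.
  obtain ⟨a, b, hab⟩ :=
    ((hprim.irreducible_iff_irreducible_map_fraction_map (K := K)).1 hF).separable
  obtain ⟨x, hxm, hx⟩ := IsLocalization.integerNormalization_spec (nonZeroDivisors R) a
  obtain ⟨y, hym, hy⟩ := IsLocalization.integerNormalization_spec (nonZeroDivisors R) b
  set a' := IsLocalization.integerNormalization (nonZeroDivisors R) a
  set b' := IsLocalization.integerNormalization (nonZeroDivisors R) b
  refine ⟨x * y, mul_ne_zero (nonZeroDivisors.ne_zero hxm) (nonZeroDivisors.ne_zero hym),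
    Polynomial.C y * a', Polynomial.C x * b', ?_⟩
  apply Polynomial.map_injective (algebraMap R K) (IsFractionRing.injective R K)
  rw [Polynomial.derivative_map] at hab
  simp only [Polynomial.map_add, Polynomial.map_mul, Polynomial.map_C, hx, hy]
  simp only [Algebra.smul_def, IsScalarTower.algebraMap_apply R K (Polynomial K),
    map_mul]
  linear_combination (Polynomial.C (algebraMap R K x) * Polynomial.C (algebraMap R K y)) * hab

/-- Infinitely many lines of the pencil are transversal to an irreducible curve. -/
theorem infinite_separable_fiber [CharZero k] {d : ℕ} {f : MvPolynomial (Fin (2 + 1)) k}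
    (hf : Irreducible f) (hfd : f.IsHomogeneous d) (hv : eval ![1, α, β] f ≠ 0) :
    {t : k | (fiber α β 1 t f).Separable}.Infinite := by
  have hirr : Irreducible (toPoly α β f) := (MulEquiv.irreducible_iff (toPoly α β)).2 hf
  have hd : (toPoly α β f).natDegree = d :=
    Polynomial.natDegree_eq_of_le_of_coeff_ne_zero (natDegree_toPoly_le α β hfd)
      (by rw [coeff_toPoly α β hfd]; simpa using hv)
  have hd0 : d ≠ 0 := by
    rintro rfl
    rw [totalDegree_eq_zero_iff_eq_C.1 ((totalDegree_zero_iff_isHomogeneous _).2 hfd)] at hf hv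
    exact hf.not_isUnit ((isUnit_iff_ne_zero.2 (by simpa using hv)).map C)
  let : NormalizedGCDMonoid (MvPolynomial (Fin 2) k) :=
    Classical.choice inferInstance
  obtain ⟨D, hD, a, b, hab⟩ := exists_eq_mul_add_mul_derivative hirr (by rwa [hd])
  intro hfin
  -- A point where this product is nonzero yields a transversal slope outside the supposedly finite
  -- set of all of them.
  have hne : D * (X 0 * ∏ t ∈ hfin.toFinset, (X 1 - C t * X 0)) ≠ 0 :=
    mul_ne_zero hD (mul_ne_zero (X_ne_zero 0)
      (Finset.prod_ne_zero_iff.2 fun t _ => (prime_slope t).ne_zero))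
  have : ∃ w, eval w (D * (X 0 * ∏ t ∈ hfin.toFinset, (X 1 - C t * X 0))) ≠ 0 := by
    by_contra! h
    exact hne (MvPolynomial.funext fun w => by rw [h w, map_zero])
  obtain ⟨w, hw⟩ := this
  simp only [map_mul, map_prod, map_sub, eval_X, eval_C, ne_eq, mul_eq_zero, not_or,
    Finset.prod_eq_zero_iff, not_exists, not_and] at hw
  obtain ⟨hDw, hw0, hw1⟩ := hw
  have hww : (![w 0, w 1] : Fin 2 → k) = w := by funext i; fin_cases i <;> rfl
  have hsep : (fiber α β (w 0) (w 1) f).Separable := by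
    rw [fiber_eq_map, hww]
    have := congrArg (Polynomial.map (eval w)) hab
    simp only [Polynomial.map_add, Polynomial.map_mul, Polynomial.map_C,
      ← Polynomial.derivative_map] at this
    refine ⟨Polynomial.C (eval w D)⁻¹ * a.map (eval w), Polynomial.C (eval w D)⁻¹ * b.map (eval w), ?_⟩
    rw [mul_assoc, mul_assoc, ← mul_add, this, ← Polynomial.C_mul, inv_mul_cancel₀ hDw,
      Polynomial.C_1]
  have hgood : (fiber α β 1 (w 1 / w 0) f).Separable :=
    (separable_comp_C_mul_X hsep hw0).of_dvd ⟨Polynomial.C (w 0) ^ d, by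
      rw [fiber_comp α β hfd hw0, mul_comm]⟩
  refine hw1 (w 1 / w 0) (hfin.mem_toFinset.2 hgood) ?_
  rw [div_mul_cancel₀ _ hw0, sub_self]

end Fiber

/-! ### Sets of points at which the lines of the pencil are transversal to the curve -/

section LocallyPrincipal

variable {k : Type*} [Field k] (α β : k)

/-- The ideal of the points with the given slopes and ordinates. -/
noncomputable def chartIdeal (S : Finset (k × k)) : Ideal (MvPolynomial (Fin (2 + 1)) k) :=
  open Classical in pointsIdeal (S.image fun p => chart α β p.1 p.2)

theorem mem_chartIdeal {S : Finset (k × k)} {u : MvPolynomial (Fin (2 + 1)) k} :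
    u ∈ chartIdeal α β S ↔ ∀ p ∈ S, u ∈ lineIdeal (chart α β p.1 p.2) := by
  classical
  rw [chartIdeal, mem_pointsIdeal]
  convert Finset.forall_mem_image

theorem isGroupOfPoints_chartIdeal (S : Finset (k × k)) : IsGroupOfPoints (chartIdeal α β S) := by
  classical
  refine isGroupOfPoints_pointsIdeal fun v hv => ?_
  obtain ⟨p, -, rfl⟩ := Finset.mem_image.1 hv
  exact chart_ne_zero α β _ _

/-- For each point of `S`, one of the two linear forms cutting it out is nonzero at `x`; multiply
these forms together. -/
theorem exists_form_eval_ne_zero (S : Finset (k × k)) {x : Fin (2 + 1) → k}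
    (hx : ∀ p ∈ S, ∀ c : k, x ≠ fun i => c * chart α β p.1 p.2 i) :
    ∃ (g : MvPolynomial (Fin (2 + 1)) k) (a : ℕ), g.IsHomogeneous a ∧ g ∈ chartIdeal α β S ∧
      eval x g ≠ 0 := by
  classical
  have h : ∀ p ∈ S, ∃ g : MvPolynomial (Fin (2 + 1)) k, g.IsHomogeneous 1 ∧
      eval (chart α β p.1 p.2) g = 0 ∧ eval x g ≠ 0 := by
    intro p hp
    by_cases hY : eval x (pencilForm α β p.1) = 0
    · refine ⟨X 0 - C p.2 * formX α, (isHomogeneous_X k 0).sub ((formX_isHomogeneous α).C_mul _),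
        ?_, fun hZ => hx p hp _ (eq_mul_chart α β hY hZ)⟩
      rw [map_sub, map_mul, eval_chart_formX, eval_chart_X_zero, eval_C, mul_one, sub_self]
    · exact ⟨_, pencilForm_isHomogeneous α β p.1, by simp, hY⟩
  choose! g hg1 hg2 hg3 using h
  refine ⟨∏ p ∈ S, g p, ∑ p ∈ S, 1, IsHomogeneous.prod _ _ _ hg1, ?_, ?_⟩
  · refine (mem_chartIdeal α β).2 fun p hp => Ideal.mem_of_dvd _ (Finset.dvd_prod_of_mem g hp) ?_
    exact (mem_lineIdeal_of_isHomogeneous (hg1 p hp)).2 (hg2 p hp)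
  · rw [map_prod]
    exact Finset.prod_ne_zero_iff.2 hg3

/-- At a point of `S`, write f = ℓ r' + z q' with ℓ, z the linear forms cutting out the point.
Transversality makes q' a unit there, so z lies locally in (ℓ, f) and ℓ generates the ideal modulo
f. -/
theorem isLocallyPrincipalIn_chartIdeal {d : ℕ} {f : MvPolynomial (Fin (2 + 1)) k}
    (hfd : f.IsHomogeneous d) {S : Finset (k × k)}
    (hS : ∀ p ∈ S, eval (chart α β p.1 p.2) f = 0 ∧ (fiber α β 1 p.1 f).Separable) :
    IsLocallyPrincipalIn (Ideal.span {f}) (chartIdeal α β S) := by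
  classical
  intro x hx0 hxf
  by_cases hx : ∀ p ∈ S, ∀ c : k, x ≠ fun i => c * chart α β p.1 p.2 i
  · obtain ⟨g, a, hg, hgS, hgx⟩ := exists_form_eval_ne_zero α β S hx
    exact ⟨g, g, a, a, hgS, hg, hg, hgx, fun u _ =>
      Ideal.mul_mem_right _ _ (Ideal.mem_sup_left (Ideal.mem_span_singleton_self g))⟩
  push Not at hx
  obtain ⟨⟨t, b⟩, hp, c, rfl⟩ := hx
  have hc : c ≠ 0 := by
    rintro rfl
    exact hx0 (by funext i; simp)
  obtain ⟨hf0, hsep⟩ := hS _ hp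
  dsimp only at hf0 hsep
  -- `g` removes the other points of `S`: it vanishes at them but not at the point considered.
  obtain ⟨g, a, hg, hgS, hgx⟩ := exists_form_eval_ne_zero α β (S.erase (t, b))
    (x := fun i => c * chart α β t b i) (by
      rintro ⟨t', b'⟩ hp' c' h
      have e : ∀ q : MvPolynomial (Fin (2 + 1)) k, q.IsHomogeneous 1 →
          c * eval (chart α β t b) q = c' * eval (chart α β t' b') q := fun q hq => by
        have h1 := eval_mul_of_isHomogeneous hq c (chart α β t b)
        have h2 := eval_mul_of_isHomogeneous hq c' (chart α β t' b')
        rw [h, h2] at h1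
        simpa using h1.symm
      have e1 := e _ (formX_isHomogeneous α)
      have e2 := e _ (formY_isHomogeneous β)
      have e3 := e _ (isHomogeneous_X k 0)
      simp only [eval_chart_formX, eval_chart_formY, eval_chart_X_zero, mul_one] at e1 e2 e3
      subst e1
      exact Finset.ne_of_mem_erase hp'
        (Prod.ext (mul_left_cancel₀ hc e2).symm (mul_left_cancel₀ hc e3).symm))
  obtain ⟨r, q, hrq⟩ := exists_eq_add_of_mem_lineIdeal α β
    ((mem_lineIdeal_of_isHomogeneous hfd).2 hf0)
  have hlin : (X 0 - C b * formX α : MvPolynomial (Fin (2 + 1)) k).IsHomogeneous 1 :=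
    (isHomogeneous_X k 0).sub ((formX_isHomogeneous α).C_mul _)
  have hd0 : 1 ≤ d := by
    by_contra! h
    obtain rfl : d = 0 := by omega
    rw [totalDegree_eq_zero_iff_eq_C.1 ((totalDegree_zero_iff_isHomogeneous _).2 hfd)] at hf0 hsep
    rw [eval_C] at hf0
    rw [hf0, C_0, map_zero] at hsep
    exact Polynomial.not_separable_zero hsep
  obtain ⟨r', q', hq', hrq'⟩ : ∃ r' q' : MvPolynomial (Fin (2 + 1)) k, q'.IsHomogeneous (d - 1) ∧
      f = pencilForm α β t * r' + (X 0 - C b * formX α) * q' := by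
    refine ⟨homogeneousComponent (d - 1) r, homogeneousComponent (d - 1) q,
      homogeneousComponent_isHomogeneous _ _, ?_⟩
    have key : ∀ l m : MvPolynomial (Fin (2 + 1)) k, l.IsHomogeneous 1 →
        homogeneousComponent d (l * m) = l * homogeneousComponent (d - 1) m := fun l m hl => by
      have := DirectSum.coe_decompose_mul_of_left_mem_of_le
        (homogeneousSubmodule (Fin (2 + 1)) k) (b := m) hl hd0
      have hdec : ∀ p i, ((DirectSum.decompose (homogeneousSubmodule (Fin (2 + 1)) k) p) i :
          MvPolynomial (Fin (2 + 1)) k) = homogeneousComponent i p := decomposition.decompose'_apply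
      rwa [hdec, hdec] at this
    have := congrArg (homogeneousComponent d) hrq
    rwa [homogeneousComponent_eq_self hfd, map_add, key _ _ (pencilForm_isHomogeneous α β t),
      key _ _ hlin] at this
  -- Otherwise `b` would be a double root of f on the line of slope `t`.
  have hq0 : eval (chart α β t b) q' ≠ 0 := by
    intro h0
    have h1 : fiber α β 1 t f = (Polynomial.X - Polynomial.C b) * fiber α β 1 t q' := by
      conv_lhs => rw [hrq']
      simp only [map_add, map_mul]
      simp [fiber, pencilForm, formX, formY]
    rw [← eval_fiber] at h0
    have h2 := Polynomial.dvd_iff_isRoot.2 h0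
    refine Polynomial.not_isUnit_X_sub_C b (hsep.squarefree _ ?_)
    rw [h1]
    exact mul_dvd_mul_left _ h2
  refine ⟨g * pencilForm α β t, g * q', _, _, ?_, hg.mul (pencilForm_isHomogeneous α β t),
    hg.mul hq', ?_, fun u hu => ?_⟩
  · refine (mem_chartIdeal α β).2 fun p hpS => ?_
    by_cases hpe : p = (t, b)
    · subst hpe
      exact Ideal.mul_mem_left _ _ ((mem_lineIdeal_of_isHomogeneous
        (pencilForm_isHomogeneous α β t)).2 (by simp))
    · exact Ideal.mul_mem_right _ _ ((mem_chartIdeal α β).1 hgS p (Finset.mem_erase.2 ⟨hpe, hpS⟩))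
  · rw [map_mul, eval_mul_of_isHomogeneous hq']
    exact mul_ne_zero hgx (mul_ne_zero (pow_ne_zero _ hc) hq0)
  · obtain ⟨r₁, q₁, rfl⟩ :=
      exists_eq_add_of_mem_lineIdeal α β ((mem_chartIdeal α β).1 hu _ hp)
    refine Submodule.mem_sup.2 ⟨g * pencilForm α β t * (q' * r₁ - r' * q₁),
      Ideal.mul_mem_right _ _ (Ideal.mem_span_singleton_self _), f * (g * q₁),
      Ideal.mul_mem_right _ _ (Ideal.mem_span_singleton_self _), ?_⟩
    linear_combination (g * q₁) * hrq'

end LocallyPrincipal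

/-! ### Bases of ideals of points over the ring of the pencil -/

section Basis

/-- The points with ordinates in `B j` on the line of slope `t j`, for `j < N`. -/
noncomputable def gridPoints {k : Type*} (N : ℕ) (t : ℕ → k) (B : ℕ → Finset k) :
    Finset (k × k) :=
  open Classical in (Finset.range N).biUnion fun j => (B j).image (Prod.mk (t j))

theorem mem_gridPoints {k : Type*} {N : ℕ} {t : ℕ → k} {B : ℕ → Finset k} {p : k × k} :
    p ∈ gridPoints N t B ↔ ∃ j < N, ∃ b ∈ B j, (t j, b) = p := by
  classical
  simp [gridPoints]

variable {k : Type*} [Field k] (α β : k)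

/-- Restricted to slope `t`, `u` has fewer than `B.card` as its degree in `X 0` but the distinct
roots `b X`, `b ∈ B`, so the restriction vanishes. -/
theorem dvd_coeff_toPoly {t : k} {B : Finset k} {u : MvPolynomial (Fin (2 + 1)) k}
    (hu : ∀ b ∈ B, u ∈ lineIdeal (chart α β t b)) (hdeg : (toPoly α β u).natDegree < B.card)
    (m : ℕ) : X 1 - C t * X 0 ∣ (toPoly α β u).coeff m := by
  have h0 : (toPoly α β u).map (restrictSlope t : MvPolynomial (Fin 2) k →+* Polynomial k) = 0 := by
    refine Polynomial.eq_zero_of_natDegree_lt_card_of_eval_eq_zero _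
      (f := fun b : B => Polynomial.C (b : k) * Polynomial.X) (fun b b' h => ?_) (fun b => ?_) ?_
    · have := congrArg (Polynomial.coeff · 1) h
      simp only [Polynomial.coeff_C_mul, Polynomial.coeff_X_one, mul_one] at this
      exact Subtype.ext this
    · rw [← lineHom_chart]
      exact hu b b.2
    · rw [Fintype.card_coe]
      exact Polynomial.natDegree_map_le.trans_lt hdeg
  have := congrArg (Polynomial.coeff · m) h0
  simp only [Polynomial.coeff_map, Polynomial.coeff_zero] at this
  exact dvd_of_restrictSlope_eq_zero this

/-- The product of the forms of slope `t j` for `j < n`. -/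
noncomputable def slopeProd (t : ℕ → k) (n : ℕ) : MvPolynomial (Fin 2) k :=
  ∏ j ∈ Finset.range n, (X 1 - C (t j) * X 0)

theorem slopeProd_ne_zero (t : ℕ → k) (n : ℕ) : slopeProd t n ≠ 0 :=
  Finset.prod_ne_zero_iff.2 fun _ _ => (prime_slope _).ne_zero

theorem slopeProd_dvd {t : ℕ → k} (ht : Function.Injective t) {n : ℕ} {q : MvPolynomial (Fin 2) k}
    (h : ∀ j < n, X 1 - C (t j) * X 0 ∣ q) : slopeProd t n ∣ q :=
  Finset.prod_dvd_of_isRelPrime (fun _ _ _ _ hij => isRelPrime_slope (ht.ne hij))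
    fun j hj => h j (Finset.mem_range.1 hj)

theorem exists_triangular_form {N : ℕ} {t : ℕ → k} (ht : Function.Injective t) {B : ℕ → Finset k}
    {i n : ℕ} (hB : ∀ j < N, n ≤ j → (B j).card ≤ i)
    (hinj : ∀ j j', j < N → j' < N → n ≤ j → n ≤ j' → (B j).card = (B j').card → j = j') :
    ∃ e : MvPolynomial (Fin (2 + 1)) k, e.IsHomogeneous (n + i) ∧
      e ∈ chartIdeal α β (gridPoints N t B) ∧ (toPoly α β e).natDegree ≤ i ∧
        (toPoly α β e).coeff i = slopeProd t n := by
  -- The value 1 at the vertex makes `p` monic of degree `i` in `X 0`; the first `n` lines are left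
  -- to the product of their equations.
  obtain ⟨p, hp, hpv, hpe⟩ := exists_form_eval_eq α β (t := t) (B := B) i
    ((Finset.range N).filter fun j => n ≤ j) ht.injOn
    (fun j hj => by
      rw [Finset.mem_filter, Finset.mem_range] at hj
      exact hB j hj.1 hj.2)
    (fun j hj j' hj' h => by
      rw [Finset.mem_coe, Finset.mem_filter, Finset.mem_range] at hj hj'
      exact hinj j j' hj.1 hj'.1 hj.2 hj'.2 h) 1 0
  have hprod : (∏ j ∈ Finset.range n, pencilForm α β (t j)).IsHomogeneous n := by
    simpa using IsHomogeneous.prod (Finset.range n) (fun j => pencilForm α β (t j)) (fun _ => 1)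
      fun j _ => pencilForm_isHomogeneous α β (t j)
  have htoPoly : toPoly α β ((∏ j ∈ Finset.range n, pencilForm α β (t j)) * p) =
      Polynomial.C (slopeProd t n) * toPoly α β p := by
    rw [map_mul, map_prod, slopeProd, map_prod]
    congr 1
    exact Finset.prod_congr rfl fun j _ => by simp [pencilForm]
  refine ⟨_, hprod.mul hp, (mem_chartIdeal α β).2 fun v hv => ?_, ?_, ?_⟩
  · obtain ⟨j, hj, b, hb, rfl⟩ := mem_gridPoints.1 hv
    rw [mem_lineIdeal_of_isHomogeneous (hprod.mul hp), map_mul]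
    by_cases hjn : j < n
    · rw [map_prod, Finset.prod_eq_zero (Finset.mem_range.2 hjn) (by simp), zero_mul]
    · rw [hpe j (Finset.mem_filter.2 ⟨Finset.mem_range.2 hj, not_lt.1 hjn⟩) b hb]
      simp
  · rw [htoPoly]
    exact (Polynomial.natDegree_C_mul_le _ _).trans (natDegree_toPoly_le α β hp)
  · rw [htoPoly, Polynomial.coeff_C_mul, coeff_toPoly α β hp, hpv, C_1, mul_one]

variable {N : ℕ} {t : ℕ → k} {B : ℕ → Finset k} {s : ℕ → ℕ} {d : ℕ}
  {e : ℕ → MvPolynomial (Fin (2 + 1)) k}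

/-- Descent on the degree in `X 0`: the top coefficient is divisible by that of `e m`, so a multiple
of `e m` can be subtracted. -/
theorem exists_eq_sum_of_mem_chartIdeal (ht : Function.Injective t)
    (hB : ∀ i < d, ∀ j < s i, j < N ∧ i < (B j).card)
    (heI : ∀ i < d, e i ∈ chartIdeal α β (gridPoints N t B))
    (hdeg : ∀ i < d, (toPoly α β (e i)).natDegree ≤ i)
    (hcoeff : ∀ i < d, (toPoly α β (e i)).coeff i = slopeProd t (s i)) {m : ℕ} (hm : m ≤ d)
    {u : MvPolynomial (Fin (2 + 1)) k} (hu : u ∈ chartIdeal α β (gridPoints N t B))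
    (hum : (toPoly α β u).degree < m) :
    ∃ r : ℕ → MvPolynomial (Fin 2) k,
      u = ∑ i ∈ Finset.range m, aeval ![formX α, formY β] (r i) * e i := by
  induction m generalizing u with
  | zero =>
    have : toPoly α β u = 0 := by
      rw [← Polynomial.degree_eq_bot]
      exact Nat.WithBot.lt_zero_iff.1 hum
    exact ⟨0, by simpa using this⟩
  | succ m ih =>
    have hle : (toPoly α β u).natDegree ≤ m :=
      Polynomial.natDegree_le_of_degree_le (Order.le_of_lt_succ (by exact_mod_cast hum))
    obtain ⟨c, hc⟩ : slopeProd t (s m) ∣ (toPoly α β u).coeff m := by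
      refine slopeProd_dvd ht fun j hj => ?_
      obtain ⟨hjN, hcard⟩ := hB m hm j hj
      exact dvd_coeff_toPoly α β (fun b hb => (mem_chartIdeal α β).1 hu (t j, b)
        (mem_gridPoints.2 ⟨j, hjN, b, hb, rfl⟩)) (hle.trans_lt hcard) m
    obtain ⟨r, hr⟩ := ih (by omega) (u := u - aeval ![formX α, formY β] c * e m)
      (Ideal.sub_mem _ hu (Ideal.mul_mem_left _ _ (heI m hm))) (by
        rw [map_sub, map_mul, toPoly_aeval]
        refine Polynomial.degree_lt_iff_coeff_zero _ _ |>.2 fun j hj => ?_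
        rw [Polynomial.coeff_sub, Polynomial.coeff_C_mul]
        rcases hj.eq_or_lt with rfl | hj
        · rw [hc, hcoeff _ hm]; ring
        · rw [Polynomial.coeff_eq_zero_of_natDegree_lt (hle.trans_lt hj),
            Polynomial.coeff_eq_zero_of_natDegree_lt ((hdeg m hm).trans_lt hj)]
          ring)
    refine ⟨Function.update r m c, ?_⟩
    rw [Finset.sum_range_succ, Function.update_self, Finset.sum_congr rfl fun i hi => by
      rw [Function.update_of_ne (Finset.mem_range.1 hi).ne], ← hr]
    ring

theorem eq_zero_of_sum_eq_zero
    (hdeg : ∀ i < d, (toPoly α β (e i)).natDegree ≤ i)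
    (hcoeff : ∀ i < d, (toPoly α β (e i)).coeff i = slopeProd t (s i)) {m : ℕ} (hm : m ≤ d)
    {r : ℕ → MvPolynomial (Fin 2) k}
    (h : ∑ i ∈ Finset.range m, Polynomial.C (r i) * toPoly α β (e i) = 0) :
    ∀ i < m, r i = 0 := by
  induction m with
  | zero => simp
  | succ m ih =>
    have hrm : r m = 0 := by
      have := congrArg (Polynomial.coeff · m) h
      rw [Polynomial.finsetSum_coeff, Polynomial.coeff_zero, Finset.sum_range_succ,
        Polynomial.coeff_C_mul, hcoeff m hm, Finset.sum_eq_zero, zero_add] at this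
      · exact (mul_eq_zero.1 this).resolve_right (slopeProd_ne_zero t _)
      · intro i hi
        rw [Finset.mem_range] at hi
        rw [Polynomial.coeff_C_mul, Polynomial.coeff_eq_zero_of_natDegree_lt
          ((hdeg i (by omega)).trans_lt hi), mul_zero]
    rw [Finset.sum_range_succ, hrm, map_zero, zero_mul, add_zero] at h
    intro i hi
    rcases (Nat.lt_succ_iff.1 hi).eq_or_lt with rfl | hi
    · exact hrm
    · exact ih (by omega) h i hi

theorem isLinearSystemOfParameters_pencil {f : MvPolynomial (Fin (2 + 1)) k}
    (hfd : f.IsHomogeneous d) (hv : eval ![1, α, β] f ≠ 0) :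
    IsLinearSystemOfParameters 1 (Ideal.span {f}) ![formX α, formY β] := by
  refine ⟨fun i => ?_, fun x hx hL => ?_⟩
  · fin_cases i
    · exact formX_isHomogeneous α
    · exact formY_isHomogeneous β
  · have h0 := hL 0
    have h1 := hL 1
    simp only [Matrix.cons_val_zero, Matrix.cons_val_one, formX, formY, map_sub, map_mul, eval_C,
      eval_X] at h0 h1
    have hx' : x = fun i => x 0 * ![1, α, β] i := by
      funext i
      fin_cases i
      · simp
      · simp; linear_combination h0
      · simp; linear_combination h1
    have hfx := hx f (Ideal.mem_span_singleton_self f)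
    rw [hx', eval_mul_of_isHomogeneous hfd] at hfx
    have hx0 := eq_zero_of_pow_eq_zero ((mul_eq_zero.1 hfx).resolve_right hv)
    rw [hx', hx0]
    funext i
    simp

theorem mk_aeval_pencil (I : Ideal (MvPolynomial (Fin (2 + 1)) k)) (q : MvPolynomial (Fin 2) k) :
    Ideal.Quotient.mk I (aeval ![formX α, formY β] q) =
      aeval (fun i => Ideal.Quotient.mk I (![formX α, formY β] i)) q := by
  have : (Ideal.Quotient.mkₐ k I).comp (aeval ![formX α, formY β]) =
      aeval fun i => Ideal.Quotient.mk I (![formX α, formY β] i) := by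
    ext i
    simp
  exact DFunLike.congr_fun this q

theorem mem_parameterSubring_pencil {I : Ideal (MvPolynomial (Fin (2 + 1)) k)}
    {x : MvPolynomial (Fin (2 + 1)) k ⧸ I} :
    x ∈ parameterSubring (m := 1) I ![formX α, formY β] ↔
      ∃ q : MvPolynomial (Fin 2) k,
        Ideal.Quotient.mk I (aeval ![formX α, formY β] q) = x := by
  simp_rw [mk_aeval_pencil]
  rw [parameterSubring, Algebra.adjoin_range_eq_range_aeval]
  rfl

theorem isRelativeCharacteristicSequence_gridPoints {f : MvPolynomial (Fin (2 + 1)) k}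
    (hfd : f.IsHomogeneous d) (hv : eval ![1, α, β] f ≠ 0) {ν : Fin d → ℕ} (hν : Monotone ν)
    (ht : Function.Injective t) (hfI : f ∈ chartIdeal α β (gridPoints N t B))
    (hB : ∀ i < d, ∀ j < s i, j < N ∧ i < (B j).card)
    (he : ∀ i : Fin d, (e i).IsHomogeneous (ν i))
    (heI : ∀ i < d, e i ∈ chartIdeal α β (gridPoints N t B))
    (hdeg : ∀ i < d, (toPoly α β (e i)).natDegree ≤ i)
    (hcoeff : ∀ i < d, (toPoly α β (e i)).coeff i = slopeProd t (s i)) :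
    IsRelativeCharacteristicSequence 1 (Ideal.span {f})
      (chartIdeal α β (gridPoints N t B)) ν := by
  refine ⟨hν, ![formX α, formY β], isLinearSystemOfParameters_pencil α β hfd hv, ?_⟩
  set IX := Ideal.span {f}
  set IY := chartIdeal α β (gridPoints N t B)
  set L : Fin (1 + 1) → MvPolynomial (Fin (2 + 1)) k := ![formX α, formY β]
  have hFcoeff := coeff_toPoly α β hfd
  have hFdeg : (toPoly α β f).degree = d :=
    Polynomial.degree_eq_of_le_of_coeff_ne_zero
      (Polynomial.degree_le_of_natDegree_le (natDegree_toPoly_le α β hfd))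
      (by rw [hFcoeff]; simpa using hv)
  let b : Fin d → relativeIdeal IX IY L := fun i =>
    ⟨Ideal.Quotient.mk IX (e i), Ideal.mem_map_of_mem _ (heI i i.2)⟩
  have hli : LinearIndependent (parameterSubring IX L) b := by
    rw [Fintype.linearIndependent_iff]
    intro g hg
    choose q hq using fun i => (mem_parameterSubring_pencil α β).1 (g i).2
    let r : ℕ → MvPolynomial (Fin 2) k := fun i => if h : i < d then q ⟨i, h⟩ else 0
    have hsum : ∑ i : Fin d, Ideal.Quotient.mk IX (aeval L (q i) * e i) = 0 := by
      have := congrArg Subtype.val hg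
      rw [AddSubmonoidClass.coe_finsetSum] at this
      refine Eq.trans ?_ this
      refine Finset.sum_congr rfl fun i _ => ?_
      rw [map_mul, hq]
      rfl
    rw [← map_sum, Ideal.Quotient.eq_zero_iff_mem, Ideal.mem_span_singleton] at hsum
    have hdvd := map_dvd (toPoly α β) hsum
    have hval : toPoly α β (∑ i : Fin d, aeval L (q i) * e i) =
        ∑ i ∈ Finset.range d, Polynomial.C (r i) * toPoly α β (e i) := by
      rw [map_sum, Finset.sum_range]
      refine Finset.sum_congr rfl fun i _ => ?_
      rw [map_mul, toPoly_aeval]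
      simp [r]
    rw [hval] at hdvd
    -- A relation modulo f is a true relation: its degree in `X 0` is below `d`, the degree of f.
    have hzero := Polynomial.eq_zero_of_dvd_of_degree_lt hdvd (by
      rw [hFdeg]
      refine (Polynomial.degree_lt_iff_coeff_zero _ _).2 fun m hm => ?_
      rw [Polynomial.finsetSum_coeff]
      refine Finset.sum_eq_zero fun i hi => ?_
      rw [Finset.mem_range] at hi
      rw [Polynomial.coeff_C_mul, Polynomial.coeff_eq_zero_of_natDegree_lt
        ((hdeg i hi).trans_lt (hi.trans_le hm)), mul_zero])
    intro i
    have := eq_zero_of_sum_eq_zero α β hdeg hcoeff le_rfl hzero i i.2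
    apply Subtype.ext
    rw [← hq i, show q i = 0 by simpa [r] using this]
    simp
  have hspan : ⊤ ≤ Submodule.span (parameterSubring IX L) (Set.range b) := by
    rintro ⟨x, hx⟩ -
    obtain ⟨u, hu, rfl⟩ :=
      (Ideal.mem_map_iff_of_surjective _ Ideal.Quotient.mk_surjective).1 hx
    set c := eval ![1, α, β] f
    set F : Polynomial (MvPolynomial (Fin 2) k) := toPoly α β (C c⁻¹ * f) with hF
    have hFmonic : F.Monic := by
      have hd : (toPoly α β f).natDegree = d := Polynomial.natDegree_eq_of_degree_eq_some hFdeg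
      rw [hF, map_mul, toPoly_C]
      refine Polynomial.monic_C_mul_of_mul_leadingCoeff_eq_one ?_
      rw [Polynomial.leadingCoeff, hd, hFcoeff, ← C_mul, inv_mul_cancel₀ hv, C_1]
    have hFd : F.degree = d := by
      rw [hF, map_mul, toPoly_C, Polynomial.degree_C_mul (by simpa using inv_ne_zero hv), hFdeg]
    -- The remainder of `u` modulo f has degree below `d` and stays in `IY`, because f does.
    set w := (toPoly α β).symm (toPoly α β u %ₘ F) with hw
    have hwu : u = w + C c⁻¹ * f * (toPoly α β).symm (toPoly α β u /ₘ F) := by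
      apply (toPoly α β).injective
      rw [map_add, map_mul, hw, AlgEquiv.apply_symm_apply, AlgEquiv.apply_symm_apply, ← hF,
        Polynomial.modByMonic_add_div]
    have hfw : u - w ∈ IX := Ideal.mem_span_singleton.2 ⟨C c⁻¹ *
      (toPoly α β).symm (toPoly α β u /ₘ F), by linear_combination hwu⟩
    have hwI : w ∈ IY := by
      have : w = u - (u - w) := by ring
      rw [this]
      exact Ideal.sub_mem _ hu ((Ideal.span_singleton_le_iff_mem _).2 hfI hfw)
    obtain ⟨r, hr⟩ := exists_eq_sum_of_mem_chartIdeal α β ht hB heI hdeg hcoeff le_rfl hwI (by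
      rw [hw, AlgEquiv.apply_symm_apply, ← hFd]
      exact Polynomial.degree_modByMonic_lt _ hFmonic)
    have hx' : (⟨Ideal.Quotient.mk IX u, hx⟩ : relativeIdeal IX IY L) = ∑ i : Fin d,
        (⟨_, (mem_parameterSubring_pencil α β).2 ⟨r i, rfl⟩⟩ : parameterSubring IX L) • b i := by
      apply Subtype.ext
      rw [AddSubmonoidClass.coe_finsetSum]
      change Ideal.Quotient.mk IX u = _
      rw [Ideal.Quotient.eq.2 hfw, hr, Finset.sum_range, map_sum]
      refine Finset.sum_congr rfl fun i _ => ?_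
      rw [map_mul]
      rfl
    rw [hx']
    exact Submodule.sum_mem _ fun i _ => Submodule.smul_mem _ _ (Submodule.subset_span ⟨i, rfl⟩)
  refine ⟨Module.Basis.mk hli hspan, fun i => ⟨e i, he i, ?_⟩⟩
  rw [Module.Basis.mk_apply]

end Basis

/-! ### Curves with prescribed relative characteristic sequences -/

/-- The conjugate of a nonincreasing sequence with steps at most `1` is strictly decreasing. -/
theorem exists_conjugate_sequence {d : ℕ} {s : ℕ → ℕ}
    (hs : ∀ i, i + 1 < d → s (i + 1) ≤ s i ∧ s i ≤ s (i + 1) + 1) :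
    ∃ a : ℕ → ℕ, (∀ j, a j ≤ d) ∧ (∀ i < d, ∀ j < s i, i < a j) ∧
      (∀ i < d, ∀ j, s i ≤ j → a j ≤ i) ∧
      ∀ i < d, ∀ j j', j < s 0 → j' < s 0 → s i ≤ j → s i ≤ j' → a j = a j' → j = j' := by
  have hanti : ∀ i < d, ∀ i' ≤ i, s i ≤ s i' := by
    intro i hi i' hii'
    induction i, hii' using Nat.le_induction with
    | base => exact le_rfl
    | succ i _ ih => exact (hs i hi).1.trans (ih (by omega))
  -- The least such `i` is the conjugate sequence at `j`; the alternative `d ≤ i` caps it at `d`.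
  have hex : ∀ j, ∃ i, d ≤ i ∨ s i ≤ j := fun j => ⟨d, Or.inl le_rfl⟩
  have hle : ∀ i < d, ∀ j, s i ≤ j → Nat.find (hex j) ≤ i := fun i _ j h =>
    Nat.find_min' _ (Or.inr h)
  -- If `j < j'` shared the value `m`, then `s m ≤ j` and `s (m - 1) > j'`, a drop of at least 2; `m
  -- = 0` is excluded by `j' < s 0`.
  have hlt : ∀ i < d, ∀ j j', j < s 0 → j' < s 0 → s i ≤ j →
      Nat.find (hex j) = Nat.find (hex j') → ¬ j < j' := by
    intro i hi j j' _ hj' hij h hjj'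
    have hmi := hle i hi j hij
    have hspec := Nat.find_spec (hex j)
    have hmin : ∀ m < Nat.find (hex j), j' < s m := fun m hm => by
      have := Nat.find_min (hex j') (h ▸ hm)
      omega
    generalize Nat.find (hex j) = m at *
    rcases m with _ | m
    · omega
    · have := hmin m (by omega)
      have := hs m (by omega)
      omega
  refine ⟨fun j => Nat.find (hex j), fun j => Nat.find_min' _ (Or.inl le_rfl),
    fun i hi j hj => (Nat.lt_find_iff _ _).2 fun i' hi' h => ?_, hle,
    fun i hi j j' hj hj' hij hij' h => ?_⟩
  · have := hanti i hi i' hi'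
    omega
  · exact le_antisymm (not_lt.1 (hlt i hi j' j hj' hj hij' h.symm))
      (not_lt.1 (hlt i hi j j' hj hj' hij h))

theorem exists_vertex {k : Type*} [Field k] [Infinite k] {d : ℕ}
    {f : MvPolynomial (Fin (2 + 1)) k} (hf : f ≠ 0) (hfd : f.IsHomogeneous d) :
    ∃ α β : k, eval ![1, α, β] f ≠ 0 := by
  obtain ⟨w, hw⟩ : ∃ w, eval w (X 0 * f) ≠ 0 := by
    by_contra! h
    exact mul_ne_zero (X_ne_zero 0) hf (MvPolynomial.funext fun w => by rw [h w, map_zero])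
  rw [map_mul, eval_X] at hw
  have hw0 : w 0 ≠ 0 := left_ne_zero_of_mul hw
  refine ⟨w 1 / w 0, w 2 / w 0, fun h => right_ne_zero_of_mul hw ?_⟩
  have hww : w = fun i => w 0 * ![1, w 1 / w 0, w 2 / w 0] i := by
    funext i
    fin_cases i <;> simp [mul_div_cancel₀ _ hw0]
  rw [hww, eval_mul_of_isHomogeneous hfd, h, mul_zero]

theorem exists_finset_roots_fiber {k : Type*} [Field k] [IsAlgClosed k] {α β : k} {d : ℕ}
    {f : MvPolynomial (Fin (2 + 1)) k} (hfd : f.IsHomogeneous d) (hv : eval ![1, α, β] f ≠ 0)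
    {t : k} (ht : (fiber α β 1 t f).Separable) {a : ℕ} (ha : a ≤ d) :
    ∃ B : Finset k, B.card = a ∧ ∀ b ∈ B, eval (chart α β t b) f = 0 := by
  classical
  have hdeg : (fiber α β 1 t f).natDegree = d := by
    rw [fiber_eq_map]
    refine Polynomial.natDegree_eq_of_le_of_coeff_ne_zero
      (Polynomial.natDegree_map_le.trans (natDegree_toPoly_le α β hfd)) ?_
    rw [Polynomial.coeff_map, coeff_toPoly α β hfd, eval_C]
    exact hv
  have hcard : (fiber α β 1 t f).roots.toFinset.card = d := by
    rw [Multiset.toFinset_card_of_nodup (Polynomial.nodup_roots ht),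
      ← (IsAlgClosed.splits (fiber α β 1 t f)).natDegree_eq_card_roots, hdeg]
  obtain ⟨B, hB, hBa⟩ := Finset.exists_subset_card_eq (ha.trans_eq hcard.symm)
  refine ⟨B, hBa, fun b hb => ?_⟩
  rw [← eval_fiber]
  exact Polynomial.isRoot_of_mem_roots (Multiset.mem_toFinset.1 (hB hb))

theorem mainTheorem9 {k : Type*} [Field k] [IsAlgClosed k] [CharZero k]
    (d : ℕ) (f : MvPolynomial (Fin (2 + 1)) k) (hf : Irreducible f) (hfd : f.IsHomogeneous d)
    (ν : Fin d → ℕ) (hν_ge : ∀ i : Fin d, (i : ℕ) ≤ ν i)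
    (hν_step : ∀ i j : Fin d, (j : ℕ) = (i : ℕ) + 1 → ν i ≤ ν j ∧ ν j ≤ ν i + 1) :
    ∃ IY : Ideal (MvPolynomial (Fin (2 + 1)) k),
      IsGroupOfPoints IY ∧ Ideal.span {f} ≤ IY ∧
        IsLocallyPrincipalIn (Ideal.span {f}) IY ∧
          IsRelativeCharacteristicSequence 1 (Ideal.span {f}) IY ν := by
  obtain ⟨α, β, hv⟩ := exists_vertex hf.ne_zero hfd
  -- `s i` will be the number of lines of the pencil whose equations divide the `i`-th basis element
  -- by construction.
  let s : ℕ → ℕ := fun i => if h : i < d then ν ⟨i, h⟩ - i else 0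
  have hs : ∀ i (h : i < d), s i + i = ν ⟨i, h⟩ := fun i h => by
    have := hν_ge ⟨i, h⟩
    simp only [s, dif_pos h]
    dsimp only at this
    omega
  have hstep : ∀ i, i + 1 < d → s (i + 1) ≤ s i ∧ s i ≤ s (i + 1) + 1 := fun i hi => by
    have h1 := hs i (by omega)
    have h2 := hs (i + 1) hi
    have h3 := hν_step ⟨i, by omega⟩ ⟨i + 1, hi⟩ rfl
    omega
  have hmono : Monotone ν := by
    rintro ⟨i, hi⟩ ⟨j, hj⟩ hij
    replace hij : i ≤ j := hij
    induction j, hij using Nat.le_induction with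
    | base => exact le_rfl
    | succ j _ ih => exact (ih (by omega)).trans (hν_step ⟨j, by omega⟩ ⟨j + 1, hj⟩ rfl).1
  obtain ⟨a, had, ha1, ha2, ha3⟩ := exists_conjugate_sequence hstep
  let τ := (infinite_separable_fiber α β hf hfd hv).natEmbedding
  let t : ℕ → k := fun j => τ j
  have htinj : Function.Injective t := Subtype.val_injective.comp τ.injective
  have htsep : ∀ j, (fiber α β 1 (t j) f).Separable := fun j => (τ j).2
  choose B hBcard hBf using fun j => exists_finset_roots_fiber hfd hv (htsep j) (had j)
  have hS : ∀ p ∈ gridPoints (s 0) t B,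
      eval (chart α β p.1 p.2) f = 0 ∧ (fiber α β 1 p.1 f).Separable := fun p hp => by
    obtain ⟨j, -, b, hb, rfl⟩ := mem_gridPoints.1 hp
    exact ⟨hBf j b hb, htsep j⟩
  have hfI : f ∈ chartIdeal α β (gridPoints (s 0) t B) := (mem_chartIdeal α β).2 fun p hp =>
    (mem_lineIdeal_of_isHomogeneous hfd).2 (hS p hp).1
  have hs0 : ∀ i < d, s i ≤ s 0 := fun i => by
    induction i with
    | zero => exact fun _ => le_rfl
    | succ i ih => exact fun hi => (hstep i hi).1.trans (ih (by omega))
  have htri : ∀ i, ∃ e : MvPolynomial (Fin (2 + 1)) k, i < d → e.IsHomogeneous (s i + i) ∧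
      e ∈ chartIdeal α β (gridPoints (s 0) t B) ∧ (toPoly α β e).natDegree ≤ i ∧
        (toPoly α β e).coeff i = slopeProd t (s i) := fun i => by
    by_cases hi : i < d
    · obtain ⟨e, he⟩ := exists_triangular_form α β (N := s 0) htinj (B := B) (i := i) (n := s i)
        (fun j _ hj => (hBcard j).trans_le (ha2 i hi j hj))
        (fun j j' hj hj' hij hij' h => ha3 i hi j j' hj hj' hij hij' (by rwa [hBcard, hBcard] at h))
      exact ⟨e, fun _ => he⟩
    · exact ⟨0, fun h => absurd h hi⟩
  choose e he using htri
  refine ⟨chartIdeal α β (gridPoints (s 0) t B), isGroupOfPoints_chartIdeal α β _,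
    (Ideal.span_singleton_le_iff_mem _).2 hfI, isLocallyPrincipalIn_chartIdeal α β hfd hS,
    isRelativeCharacteristicSequence_gridPoints α β hfd hv hmono htinj hfI (s := s) (e := e)
      (fun i hi j hj => ⟨hj.trans_le (hs0 i hi), (hBcard j).symm ▸ ha1 i hi j hj⟩)
      (fun i => hs i i.2 ▸ (he i i.2).1) (fun i hi => (he i hi).2.1) (fun i hi => (he i hi).2.2.1)
      (fun i hi => (he i hi).2.2.2)⟩
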